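/- **Theorem 5.3.** Let $\mathfrak B$ be a Banach space over $\mathbb R$ or $\mathbb C$, let $[\mathfrak B]$ be the Banach space of bounded linear operators on $\mathfrak B$, and let $(A,f)\in C(\mathbb R,[\mathfrak B])\times C(\mathbb R,\mathfrak B)$. Let $U(t)$ be the Cauchy operator of $$x'=A(t)x, \tag{1}$$ i.e. $U'(t)=A(t)U(t)$, $U(0)=I$. We use the following terms. - A function $\varphi\in C(\mathbb R,X)$ with values in a metric space $(X,\rho)$ is *Lagrange stable* if the set of its translates $\{\varphi(\cdot+h): h\in\mathbb R\}$ is relatively compact in $C(\mathbb R,X)$ with the topology of uniform convergence on compact sets. - $\varphi$ is *two-sided remotely almost periodic* if for every $\varepsilon>0$ there is a relatively dense set $\mathcal P\subseteq\mathbb R$ (for some $l>0$ it meets every interval $[a,a+l]$) such that for each $\tau\in\mathcal P$ there is $L>0$ with $\rho(\varphi(t+\tau),\varphi(t))<\varepsilon$ whenever $|t|\ge L$. For $\tau>0$, $\varphi$ is *two-sided remotely $\tau$-periodic* if $\rho(\varphi(t+\tau),\varphi(t))\to0$ both as $t\to+\infty$ and as $t\to-\infty$. It is *two-sided remotely stationary*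 if it is two-sided remotely $\tau$-periodic for every $\tau>0$. - The pair $(A,f)$ is regarded as a function in $C(\mathbb R,[\mathfrak B]\times\mathfrak B)$. - Equation (1) has an *exponential trichotomy* on $\mathbb R$ (with projections $P,Q$) if $P,Q\in[\mathfrak B]$ are projections with $PQ=QP$ and $P+Q-PQ=I$, and there are constants $\mathcal N\ge1$, $\nu>0$ such that $$\begin{aligned} \|U(t)PU^{-1}(\tau)\|&\le\mathcal N e^{-\nu(t-\tau)} && (0\le\tau\le t),\\ \|U(t)(I-P)U^{-1}(\tau)\|&\le\mathcal N e^{-\nu(\tau-t)} && (t\le\tau,\ \tau\ge0),\\ \|U(t)QU^{-1}(\tau)\|&\le\mathcal N e^{-\nu(\tau-t)} && (t\le\tau\le0),\\ \|U(t)(I-Q)U^{-1}(\tau)\|&\le\mathcal N e^{-\nu(t-\tau)} && (\tau\le t,\ \tau\le0). \end{aligned}$$ Its *Green function* is $$G_A(t,\tau)=\begin{cases}U(t)PU^{-1}(\tau),&0\le\tau<t,\\ -U(t)(I-P)U^{-1}(\tau),&t\le\tau,\ \tau\ge0,\\ -U(t)QU^{-1}(\tau),&t\le\tau<0,\\ U(t)(I-Q)U^{-1}(\tau),&\tau<t,\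 \tau<0.\end{cases}$$ Suppose that $(A,f)$ is Lagrange stable and two-sided remotely almost periodic (respectively, two-sided remotely $\tau$-periodic for a given $\tau>0$; respectively, two-sided remotely stationary), and that (1) has an exponential trichotomy on $\mathbb R$ with projections $P,Q$. Then: 1. the equation $$x'=A(t)x+f(t) \tag{2}$$ has at least one solution $\varphi\in C(\mathbb R,\mathfrak B)$ that is two-sided remotely almost periodic (respectively, two-sided remotely $\tau$-periodic; respectively, two-sided remotely stationary); 2. the solution $\varphi$ is given by the absolutely convergent integral $\varphi(t)=\int_{-\infty}^{+\infty}G_A(t,\tau)f(\tau)\,d\tau$ for every $t\in\mathbb R$; 3. every solution of (2) that is bounded on $\mathbb R$ is two-sided remotely almost periodic (respectively, two-sided remotely $\tau$-periodic; respectively, two-sided remotely stationary). -/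

import Mathlib

open Filter Topology MeasureTheory

noncomputable section

/-! ### The Cauchy operator of a linear equation -/

/-- `U` is the operator solution of `U' = A(t) U`, `U(0) = 1`, in a normed ring of coefficients
(below: the bounded operators on a Banach space). -/
def IsCauchyOperator {R : Type*} [NormedRing R] [NormedSpace ℝ R] (A : ℝ → R) (U : ℝ → R) : Prop :=
  U 0 = 1 ∧ ∀ t : ℝ, HasDerivAt U (A t * U t) t

/-- The iterated integrals whose sum solves `U' = A(t) U`, `U(0) = 1`. -/
def iteratedCauchyIntegral {R : Type*} [NormedRing R] [NormedSpace ℝ R] (A : ℝ → R) : ℕ → ℝ → R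
  | 0 => fun _ => 1
  | n + 1 => fun t => ∫ s in (0 : ℝ)..t, A s * iteratedCauchyIntegral A n s

theorem continuous_iteratedCauchyIntegral {R : Type*} [NormedRing R] [NormedSpace ℝ R]
    [CompleteSpace R] {A : ℝ → R} (hA : Continuous A) (n : ℕ) :
    Continuous (iteratedCauchyIntegral A n) := by
  induction n with
  | zero => exact continuous_const
  | succ n ih =>
    exact intervalIntegral.continuous_primitive
      (fun a b => (hA.mul ih).intervalIntegrable a b) 0

theorem norm_iteratedCauchyIntegral_le {R : Type*} [NormedRing R] [NormedSpace ℝ R]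
    [CompleteSpace R] {A : ℝ → R} (hA : Continuous A) {T C : ℝ} (hC : 0 ≤ C)
    (hAC : ∀ s, |s| ≤ T → ‖A s‖ ≤ C) (n : ℕ) (t : ℝ) (ht : |t| ≤ T) :
    ‖iteratedCauchyIntegral A n t‖ ≤ ‖(1 : R)‖ * ((C * |t|) ^ n / (n.factorial : ℝ)) := by
  induction n generalizing t with
  | zero => simp [iteratedCauchyIntegral]
  | succ n ih =>
    have hst : ∀ s ∈ Set.uIoc 0 t, |s| ≤ T := by
      intro s hs
      refine le_trans ?_ ht
      rcases Set.mem_uIoc.1 hs with h | h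
      · rw [abs_of_pos h.1, abs_of_pos (h.1.trans_le h.2)]; exact h.2
      · rw [abs_of_nonpos h.2, abs_of_neg (h.1.trans_le h.2)]; linarith [h.1]
    have hint : ∫ s in Set.uIoc 0 t, C * (‖(1 : R)‖ * ((C * |s - 0|) ^ n / (n.factorial : ℝ)))
        = ‖(1 : R)‖ * ((C * |t|) ^ (n + 1) / ((n + 1).factorial : ℝ)) := by
      have h := integral_pow_abs_sub_uIoc (a := 0) (b := t) (n := n)
      have h2 : (fun s : ℝ => C * (‖(1 : R)‖ * ((C * |s - 0|) ^ n / (n.factorial : ℝ))))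
          = fun s => (C * ‖(1 : R)‖ * C ^ n / (n.factorial : ℝ)) * |s - 0| ^ n := by
        funext s; rw [mul_pow]; ring
      rw [h2, integral_const_mul, h, Nat.factorial_succ, sub_zero]
      have : (n.factorial : ℝ) ≠ 0 := by positivity
      push_cast
      field_simp
      ring
    rw [← hint]
    refine (intervalIntegral.norm_integral_le_integral_norm_uIoc).trans ?_
    refine setIntegral_mono_on ?_ ?_ measurableSet_uIoc ?_
    · exact ((hA.mul (continuous_iteratedCauchyIntegral hA n)).norm.intervalIntegrable 0 t).def'
    · exact (Continuous.intervalIntegrable (by fun_prop) 0 t).def'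
    · intro s hs
      rw [sub_zero]
      exact (norm_mul_le _ _).trans
        (mul_le_mul (hAC s (hst s hs)) (ih s (hst s hs)) (norm_nonneg _) hC)

/-- Every linear equation with continuous coefficients has a Cauchy operator. -/
theorem exists_isCauchyOperator {R : Type*} [NormedRing R] [NormedSpace ℝ R]
    [CompleteSpace R] {A : ℝ → R} (hA : Continuous A) : ∃ U : ℝ → R, IsCauchyOperator A U := by
  have key : ∀ T : ℝ, 0 < T → ∃ u : ℕ → ℝ, Summable u ∧
      (∀ n t, |t| ≤ T → ‖iteratedCauchyIntegral A n t‖ ≤ u n) ∧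
      (∀ n t, |t| ≤ T → ‖A t * iteratedCauchyIntegral A n t‖ ≤ u n) := by
    intro T hT
    obtain ⟨C, hC⟩ := (isCompact_Icc (a := -T) (b := T)).exists_bound_of_continuousOn
      hA.continuousOn
    have hC' : ∀ s, |s| ≤ T → ‖A s‖ ≤ max C 1 := fun s hs =>
      (hC s (abs_le.1 hs)).trans (le_max_left _ _)
    have h1 : (1 : ℝ) ≤ max C 1 := le_max_right _ _
    have h0 : (0 : ℝ) ≤ max C 1 := zero_le_one.trans h1
    have hb : ∀ n t, |t| ≤ T → ‖iteratedCauchyIntegral A n t‖ ≤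
        ‖(1 : R)‖ * ((max C 1 * T) ^ n / (n.factorial : ℝ)) := by
      intro n t ht
      refine (norm_iteratedCauchyIntegral_le hA h0 hC' n t ht).trans ?_
      gcongr
    refine ⟨fun n => max C 1 * (‖(1 : R)‖ * ((max C 1 * T) ^ n / (n.factorial : ℝ))),
      ((Real.summable_pow_div_factorial _).mul_left _).mul_left _, ?_, ?_⟩
    · intro n t ht
      exact (hb n t ht).trans (le_mul_of_one_le_left (by positivity) h1)
    · intro n t ht
      exact (norm_mul_le _ _).trans (mul_le_mul (hC' t ht) (hb n t ht) (norm_nonneg _) h0)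
  have hsum : ∀ t, Summable fun n => iteratedCauchyIntegral A n t := by
    intro t
    obtain ⟨u, hu, h, -⟩ := key (|t| + 1) (by positivity)
    exact .of_norm_bounded hu fun n => h n t (by linarith)
  have hU : ∀ t, (∑' n, iteratedCauchyIntegral A n t)
      = 1 + ∑' n, iteratedCauchyIntegral A (n + 1) t := fun t => (hsum t).tsum_eq_zero_add
  refine ⟨fun t => ∑' n, iteratedCauchyIntegral A n t, ?_, ?_⟩
  · simp [hU, iteratedCauchyIntegral]
  · intro t
    obtain ⟨u, hu, -, h⟩ := key (|t| + 1) (by positivity)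
    have hd : HasDerivAt (fun z => ∑' n, iteratedCauchyIntegral A (n + 1) z)
        (∑' n, A t * iteratedCauchyIntegral A n t) t := by
      refine hasDerivAt_tsum_of_isPreconnected
        (g' := fun n y => A y * iteratedCauchyIntegral A n y) (t := Set.Ioo (-(|t| + 1)) (|t| + 1)) (y₀ := t) hu
        isOpen_Ioo isPreconnected_Ioo ?_ ?_ ?_ ((summable_nat_add_iff 1).2 (hsum t)) ?_
      · intro n y _
        have hc := hA.mul (continuous_iteratedCauchyIntegral hA n)
        exact intervalIntegral.integral_hasDerivAt_right (hc.intervalIntegrable _ _)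
          (hc.stronglyMeasurableAtFilter _ _) hc.continuousAt
      · intro n y hy
        exact h n y (abs_le.2 ⟨hy.1.le, hy.2.le⟩)
      · exact abs_lt.1 (lt_add_one _)
      · exact abs_lt.1 (lt_add_one _)
    rw [(hsum t).tsum_mul_left] at hd
    have he : (fun t => ∑' n, iteratedCauchyIntegral A n t)
        = fun t => 1 + ∑' n, iteratedCauchyIntegral A (n + 1) t := funext hU
    rw [he]
    simpa [← hU t] using hd.const_add 1

section Equation

variable {𝕜 : Type*} [RCLike 𝕜] {B : Type*} [NormedAddCommGroup B] [NormedSpace 𝕜 B]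
  [NormedSpace ℝ B] [IsScalarTower ℝ 𝕜 B] [CompleteSpace B]

/-- The Cauchy operator `U(t, A)` of `x' = A(t) x`: the solution of `U' = A(t) U`, `U(0) = I` in
the Banach algebra of bounded operators. -/
def cauchyOperator (A : C(ℝ, B →L[𝕜] B)) : ℝ → B →L[𝕜] B :=
  (exists_isCauchyOperator A.continuous).choose

theorem cauchyOperator_spec (A : C(ℝ, B →L[𝕜] B)) : IsCauchyOperator A (cauchyOperator A) :=
  (exists_isCauchyOperator A.continuous).choose_spec

/-- The operator `U(t, A) S U⁻¹(τ, A)`. (The operators `U(τ, A)` are invertible, so that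
`Ring.inverse` is the genuine inverse.) -/
def evolutionThrough (A : C(ℝ, B →L[𝕜] B)) (S : B →L[𝕜] B) (t τ : ℝ) : B →L[𝕜] B :=
  cauchyOperator A t * S * Ring.inverse (cauchyOperator A τ)

/-- The equation `x' = A(t) x` has an exponential trichotomy on `ℝ` with the projections
`P` and `Q`. -/
structure HasExponentialTrichotomyWith (A : C(ℝ, B →L[𝕜] B)) (P Q : B →L[𝕜] B) : Prop where
  proj_left : P * P = P
  proj_right : Q * Q = Q
  comm : P * Q = Q * P
  add_sub_mul : P + Q - P * Q = 1
  bound : ∃ N ν : ℝ, 1 ≤ N ∧ 0 < ν ∧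
    (∀ t τ : ℝ, 0 ≤ τ → τ ≤ t → ‖evolutionThrough A P t τ‖ ≤ N * Real.exp (-ν * (t - τ))) ∧
    (∀ t τ : ℝ, t ≤ τ → 0 ≤ τ → ‖evolutionThrough A (1 - P) t τ‖ ≤ N * Real.exp (-ν * (τ - t))) ∧
    (∀ t τ : ℝ, t ≤ τ → τ ≤ 0 → ‖evolutionThrough A Q t τ‖ ≤ N * Real.exp (-ν * (τ - t))) ∧
    (∀ t τ : ℝ, τ ≤ t → τ ≤ 0 → ‖evolutionThrough A (1 - Q) t τ‖ ≤ N * Real.exp (-ν * (t - τ)))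

/-- The Green function of an equation with exponential trichotomy:
`U(t) P U⁻¹(τ)` for `0 ≤ τ < t`, `-U(t) (I - P) U⁻¹(τ)` for `t ≤ τ`, `0 ≤ τ`,
`-U(t) Q U⁻¹(τ)` for `t ≤ τ < 0`, and `U(t) (I - Q) U⁻¹(τ)` for `τ < t`, `τ < 0`.
(Other conventions at `τ = 0` and `τ = t` change it, for fixed `t`, at two points `τ` only.) -/
def greenFunction (A : C(ℝ, B →L[𝕜] B)) (P Q : B →L[𝕜] B) (t τ : ℝ) : B →L[𝕜] B :=
  if 0 ≤ τ then
    if τ < t then evolutionThrough A P t τ else -evolutionThrough A (1 - P) t τ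
  else
    if t ≤ τ then -evolutionThrough A Q t τ else evolutionThrough A (1 - Q) t τ

/-- `x` is a solution on `ℝ` of `x' = A(t) x + f(t)`. -/
def IsSolution (A : C(ℝ, B →L[𝕜] B)) (f : C(ℝ, B)) (x : C(ℝ, B)) : Prop :=
  ∀ t : ℝ, HasDerivAt x (A t (x t) + f t) t

end Equation

/-! ### Recurrence of functions on the line -/

/-- The translate `φ^h(t) = φ(t + h)`. -/
def shift {X : Type*} [TopologicalSpace X] (h : ℝ) (φ : C(ℝ, X)) : C(ℝ, X) :=
  φ.comp ⟨fun t => t + h, by fun_prop⟩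

/-- Lagrange stability: the set of translates is relatively compact in `C(ℝ, X)`, with the
topology of uniform convergence on compact sets. -/
def LagrangeStable {X : Type*} [MetricSpace X] (φ : C(ℝ, X)) : Prop :=
  IsCompact (closure (Set.range fun h : ℝ => shift h φ))

/-- `S` meets every interval `[a, a + l]` of some fixed length `l > 0`. -/
def RelativelyDense (S : Set ℝ) : Prop :=
  ∃ l : ℝ, 0 < l ∧ ∀ a : ℝ, (Set.Icc a (a + l) ∩ S).Nonempty

/-- Two-sided remotely almost periodic. -/
def TwoSidedRemotelyAlmostPeriodic {X : Type*} [MetricSpace X] (φ : C(ℝ, X)) : Prop :=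
  ∀ ε : ℝ, 0 < ε → ∃ S : Set ℝ, RelativelyDense S ∧
    ∀ τ ∈ S, ∃ L : ℝ, 0 < L ∧ ∀ t : ℝ, L ≤ |t| → dist (φ (t + τ)) (φ t) < ε

/-- Two-sided remotely `τ`-periodic: remotely `τ`-periodic at `+∞` and at `-∞`. -/
def TwoSidedRemotelyPeriodic {X : Type*} [MetricSpace X] (τ : ℝ) (φ : C(ℝ, X)) : Prop :=
  Tendsto (fun t => dist (φ (t + τ)) (φ t)) atTop (𝓝 0) ∧
    Tendsto (fun t => dist (φ (t + τ)) (φ t)) atBot (𝓝 0)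

/-- Two-sided remotely stationary: two-sided remotely `τ`-periodic for every `τ > 0`. -/
def TwoSidedRemotelyStationary {X : Type*} [MetricSpace X] (φ : C(ℝ, X)) : Prop :=
  ∀ τ : ℝ, 0 < τ → TwoSidedRemotelyPeriodic τ φ

end

/-!
Write `φ` for the Green integral of `f`. The Cauchy operator `U` is invertible, its inverse solving
the adjoint equation `V' = -V A(t)`, and the Green function satisfies
`G(t, τ) = U(t) (G(0, τ) ± U⁻¹(τ) 1_{τ between 0 and t})` (`greenFunction_apply_eq`). Hence `φ` has
the form `U(t) (c + ∫₀ᵗ U⁻¹ f)` given by the variation of constants, and it solves the equation.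
The trichotomy gives `‖G(t, τ)‖ ≤ N exp (-ν |t - τ|)`, so `φ` converges absolutely and is bounded;
the boundedness of `f` is all that is needed from Lagrange stability.

Recurrence is proved for every bounded solution `ψ` at once, without passing to limit equations.
The difference `y = ψ(· + τ) - ψ` is a bounded solution of `y' = A(t) y + g(t)` with
`g = (A(· + τ) - A) ψ(· + τ) + f(· + τ) - f`. If `(A, f)(· + τ)` is remotely `δ`-close to `(A, f)`,
then `g` is remotely of size `O(δ)`. Now `y` is the Green integral of `g` plus a bounded solution of
the homogeneous equation. The latter starts in the ranges of both `P` and `Q`, and so it vanishes at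
`±∞` (`HasExponentialTrichotomyWith.tendsto_norm_zero_of_isSolution_zero`); the former is remotely
`O(δ)` because the kernel decays exponentially (`norm_integral_greenFunction_le`). So `y` is remotely
`O(δ)`, with a constant that does not depend on `τ`
(`HasExponentialTrichotomyWith.exists_eventually_dist_shift_lt`), and all three kinds of recurrence
pass from `(A, f)` to `ψ`.
-/

/-! ### Invertibility of the Cauchy operator -/

section Ring

variable {R : Type*} [NormedRing R] [NormedSpace ℝ R] [IsScalarTower ℝ R R] [SMulCommClass ℝ R R]

theorem hasDerivAt_ring_mul {u v : ℝ → R} {u' v' : R} {t : ℝ} (hu : HasDerivAt u u' t)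
    (hv : HasDerivAt v v' t) : HasDerivAt (fun s => u s * v s) (u t * v' + u' * v t) t :=
  (ContinuousLinearMap.mul ℝ R).hasDerivAt_of_bilinear (fun _ => hu) (fun _ => hv)

/-- The inverse of the Cauchy operator solves the adjoint equation `V' = -V A(t)`. It is obtained
as the Cauchy operator of `-A` in the opposite ring. -/
theorem IsCauchyOperator.exists_inverse [CompleteSpace R] {A U : ℝ → R} (hA : Continuous A)
    (hU : IsCauchyOperator A U) :
    ∃ V : ℝ → R, (∀ t, HasDerivAt V (-(V t * A t)) t) ∧ (∀ t, V t * U t = 1) ∧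
      ∀ t, U t * V t = 1 := by
  obtain ⟨W, hW0, hW⟩ := exists_isCauchyOperator (R := Rᵐᵒᵖ)
    (A := fun t => MulOpposite.op (-A t)) (MulOpposite.continuous_op.comp hA.neg)
  have hV : ∀ t, HasDerivAt (fun s => (W s).unop) (-((W t).unop * A t)) t := fun t => by
    have h := (MulOpposite.opContinuousLinearEquiv ℝ (M := R)).symm.hasFDerivAt.comp_hasDerivAt
      t (hW t)
    simp only [neg_mul, MulOpposite.op_neg] at h
    exact h
  have hVU : ∀ t, (W t).unop * U t = 1 := by
    have hd : ∀ t, HasDerivAt (fun s => (W s).unop * U s) 0 t := fun t => by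
      convert hasDerivAt_ring_mul (hV t) (hU.2 t) using 1
      simp [mul_assoc]
    intro t
    rw [is_const_of_deriv_eq_zero (fun s => (hd s).differentiableAt) (fun s => (hd s).deriv) t 0]
    simp [hW0, hU.1]
  have hUc : Continuous U := continuous_iff_continuousAt.2 fun t => (hU.2 t).continuousAt
  have hVc : Continuous fun s => (W s).unop :=
    continuous_iff_continuousAt.2 fun t => (hV t).continuousAt
  refine ⟨fun s => (W s).unop, hV, hVU, ?_⟩
  -- A left inverse is two-sided where `U` is a unit: the set of such times is open because units
  -- are, and closed because it is given by the equation `U V = 1`.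
  have hclopen : IsClopen {t : ℝ | U t * (W t).unop = 1} := by
    refine ⟨isClosed_eq (hUc.mul hVc) continuous_const, ?_⟩
    have : {t : ℝ | U t * (W t).unop = 1} = U ⁻¹' {x | IsUnit x} := by
      ext t
      refine ⟨fun h => ⟨⟨U t, _, h, hVU t⟩, rfl⟩, fun h => ?_⟩
      obtain ⟨u, hu⟩ : IsUnit (U t) := h
      have h1 := hVU t
      rw [← hu] at h1
      change U t * (W t).unop = 1
      rw [← hu, Units.eq_inv_of_mul_eq_one_right h1, Units.mul_inv]
    rw [this]
    exact Units.isOpen.preimage hUc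
  have huniv := hclopen.eq_univ ⟨0, by simp [hW0, hU.1]⟩
  exact fun t => (Set.ext_iff.1 huniv t).2 trivial

end Ring

section Equation

variable {𝕜 : Type*} [RCLike 𝕜] {B : Type*} [NormedAddCommGroup B] [NormedSpace 𝕜 B]
  [NormedSpace ℝ B] [IsScalarTower ℝ 𝕜 B]

/-- The product rule for the evaluation of a `𝕜`-linear operator, with a real time variable. -/
theorem hasDerivAt_operator_apply {T : ℝ → B →L[𝕜] B} {T' : B →L[𝕜] B} {x : ℝ → B} {x' : B}
    {t : ℝ} (hT : HasDerivAt T T' t) (hx : HasDerivAt x x' t) :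
    HasDerivAt (fun s => T s (x s)) (T' (x t) + T t x') t :=
  ((ContinuousLinearMap.restrictScalarsL 𝕜 B B ℝ ℝ).hasFDerivAt.comp_hasDerivAt t hT).clm_apply hx

theorem integral_Ico_sub_integral_Ico (v : ℝ → B) (a b : ℝ) :
    (∫ s in Set.Ico a b, v s) - ∫ s in Set.Ico b a, v s = ∫ s in a..b, v s := by
  rw [intervalIntegral, integral_Ico_eq_integral_Ioc, integral_Ico_eq_integral_Ioc]

variable [CompleteSpace B]

/-- `Ring.inverse` of the Cauchy operator is a genuine two-sided inverse, and it solves the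
adjoint equation. -/
theorem inverse_cauchyOperator_spec (A : C(ℝ, B →L[𝕜] B)) :
    (∀ t, HasDerivAt (fun s => Ring.inverse (cauchyOperator A s))
      (-(Ring.inverse (cauchyOperator A t) * A t)) t) ∧
    (∀ t, Ring.inverse (cauchyOperator A t) * cauchyOperator A t = 1) ∧
    ∀ t, cauchyOperator A t * Ring.inverse (cauchyOperator A t) = 1 := by
  obtain ⟨V, hV, hVU, hUV⟩ := (cauchyOperator_spec A).exists_inverse A.continuous
  have : (fun s => Ring.inverse (cauchyOperator A s)) = V := funext fun s =>
    Ring.inverse_unit (⟨cauchyOperator A s, V s, hUV s, hVU s⟩ : (B →L[𝕜] B)ˣ)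
  have ht : ∀ t, Ring.inverse (cauchyOperator A t) = V t := congr_fun this
  rw [this]
  exact ⟨fun t => by rw [ht]; exact hV t, fun t => by rw [ht]; exact hVU t,
    fun t => by rw [ht]; exact hUV t⟩

theorem continuous_inverse_cauchyOperator (A : C(ℝ, B →L[𝕜] B)) :
    Continuous fun s => Ring.inverse (cauchyOperator A s) :=
  continuous_iff_continuousAt.2 fun t => ((inverse_cauchyOperator_spec A).1 t).continuousAt

theorem cauchyOperator_zero (A : C(ℝ, B →L[𝕜] B)) : cauchyOperator A 0 = 1 :=
  (cauchyOperator_spec A).1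

theorem evolutionThrough_zero_left (A : C(ℝ, B →L[𝕜] B)) (S : B →L[𝕜] B) (τ : ℝ) :
    evolutionThrough A S 0 τ = S * Ring.inverse (cauchyOperator A τ) := by
  simp [evolutionThrough, cauchyOperator_zero]

theorem evolutionThrough_zero_right (A : C(ℝ, B →L[𝕜] B)) (S : B →L[𝕜] B) (t : ℝ) :
    evolutionThrough A S t 0 = cauchyOperator A t * S := by
  simp [evolutionThrough, cauchyOperator_zero]

theorem IsSolution.eq_cauchyOperator_apply {A : C(ℝ, B →L[𝕜] B)} {y : C(ℝ, B)}
    (hy : IsSolution A 0 y) (t : ℝ) : y t = cauchyOperator A t (y 0) := by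
  have hd : ∀ t, HasDerivAt (fun s => Ring.inverse (cauchyOperator A s) (y s)) 0 t := fun t => by
    convert hasDerivAt_operator_apply ((inverse_cauchyOperator_spec A).1 t) (hy t) using 1
    simp
  have h := is_const_of_deriv_eq_zero (fun s => (hd s).differentiableAt) (fun s => (hd s).deriv) t 0
  have h1 := congr_arg (cauchyOperator A t) h
  rw [← mul_apply_eq_comp, (inverse_cauchyOperator_spec A).2.2] at h1
  simpa [cauchyOperator_zero] using h1

/-- Variation of constants. -/
theorem hasDerivAt_variation_of_constants (A : C(ℝ, B →L[𝕜] B)) {g : ℝ → B} (hg : Continuous g)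
    (c : B) (t : ℝ) :
    HasDerivAt
      (fun t => cauchyOperator A t (c + ∫ s in (0 : ℝ)..t, Ring.inverse (cauchyOperator A s) (g s)))
      (A t (cauchyOperator A t
        (c + ∫ s in (0 : ℝ)..t, Ring.inverse (cauchyOperator A s) (g s))) + g t) t := by
  have hc : Continuous fun s => Ring.inverse (cauchyOperator A s) (g s) :=
    (continuous_inverse_cauchyOperator A).clm_apply hg
  have hint := intervalIntegral.integral_hasDerivAt_right (hc.intervalIntegrable 0 t)
    (hc.stronglyMeasurableAtFilter _ _) hc.continuousAt
  convert hasDerivAt_operator_apply ((cauchyOperator_spec A).2 t) (hint.const_add c) using 1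
  congr 1
  change g t = (cauchyOperator A t * Ring.inverse (cauchyOperator A t)) (g t)
  rw [(inverse_cauchyOperator_spec A).2.2]
  rfl

/-! ### The Green function -/

/-- Passing from `t` to `0`, the Green function changes by the evolution operator between `0`
and `t`; this is where the jump `P + (1 - P) = 1` (respectively `Q + (1 - Q) = 1`) enters. -/
theorem greenFunction_apply_eq (A : C(ℝ, B →L[𝕜] B)) (P Q : B →L[𝕜] B) (g : ℝ → B) (t τ : ℝ) :
    greenFunction A P Q t τ (g τ) = cauchyOperator A t (greenFunction A P Q 0 τ (g τ) +
      ((Set.Ico 0 t).indicator (fun s => Ring.inverse (cauchyOperator A s) (g s)) τ -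
        (Set.Ico t 0).indicator (fun s => Ring.inverse (cauchyOperator A s) (g s)) τ)) := by
  simp only [Set.indicator, Set.mem_Ico]
  unfold greenFunction
  rcases le_or_gt 0 τ with h0 | h0 <;> rcases lt_or_ge τ t with ht | ht <;>
    simp [h0, ht, not_lt_of_ge, not_le_of_gt, evolutionThrough, cauchyOperator_zero]
  abel

theorem HasExponentialTrichotomyWith.exists_norm_greenFunction_le {A : C(ℝ, B →L[𝕜] B)}
    {P Q : B →L[𝕜] B} (h : HasExponentialTrichotomyWith A P Q) :
    ∃ N ν : ℝ, 0 < N ∧ 0 < ν ∧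
      ∀ t τ, ‖greenFunction A P Q t τ‖ ≤ N * Real.exp (-ν * |t - τ|) := by
  obtain ⟨N, ν, hN, hν, h1, h2, h3, h4⟩ := h.bound
  refine ⟨N, ν, by linarith, hν, fun t τ => ?_⟩
  unfold greenFunction
  split_ifs with h0 ht ht
  · rw [abs_of_pos (sub_pos.2 ht)]
    exact h1 t τ h0 ht.le
  · rw [norm_neg, abs_sub_comm, abs_of_nonneg (by linarith)]
    exact h2 t τ (by linarith) h0
  · rw [norm_neg, abs_sub_comm, abs_of_nonneg (by linarith)]
    exact h3 t τ ht (by linarith)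
  · rw [abs_of_nonneg (by linarith)]
    exact h4 t τ (by linarith) (by linarith)

theorem aestronglyMeasurable_greenFunction_apply (A : C(ℝ, B →L[𝕜] B)) (P Q : B →L[𝕜] B)
    {g : ℝ → B} (hg : Continuous g) (t : ℝ) :
    AEStronglyMeasurable fun τ => greenFunction A P Q t τ (g τ) := by
  have hc : ∀ S, StronglyMeasurable fun τ => evolutionThrough A S t τ (g τ) := fun S =>
    ((continuous_const.mul (continuous_inverse_cauchyOperator A)).clm_apply hg).stronglyMeasurable
  refine StronglyMeasurable.aestronglyMeasurable ?_
  have : (fun τ => greenFunction A P Q t τ (g τ)) = fun τ => if 0 ≤ τ then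
      if τ < t then evolutionThrough A P t τ (g τ) else -evolutionThrough A (1 - P) t τ (g τ)
    else
      if t ≤ τ then -evolutionThrough A Q t τ (g τ) else evolutionThrough A (1 - Q) t τ (g τ) := by
    ext τ
    unfold greenFunction
    split_ifs <;> rfl
  rw [this]
  exact ((hc P).ite measurableSet_Iio (hc (1 - P)).neg).ite measurableSet_Ici
    ((hc Q).neg.ite measurableSet_Ici (hc (1 - Q)))

theorem integrable_exp_neg_mul_abs {ν : ℝ} (hν : 0 < ν) :
    Integrable fun s : ℝ => Real.exp (-ν * |s|) := by
  rw [← integrableOn_univ, ← Set.Iic_union_Ioi (a := (0 : ℝ)), integrableOn_union]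
  constructor
  · refine (integrableOn_exp_mul_Iic hν 0).congr_fun (fun s hs => ?_) measurableSet_Iic
    simp [abs_of_nonpos (Set.mem_Iic.1 hs)]
  · refine (integrableOn_exp_mul_Ioi (neg_neg_of_pos hν) 0).congr_fun (fun s hs => ?_)
      measurableSet_Ioi
    simp [abs_of_pos (Set.mem_Ioi.1 hs)]

theorem integrable_greenFunction_apply {A : C(ℝ, B →L[𝕜] B)} {P Q : B →L[𝕜] B} {N ν : ℝ}
    (hν : 0 < ν) (hG : ∀ t τ, ‖greenFunction A P Q t τ‖ ≤ N * Real.exp (-ν * |t - τ|))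
    {g : ℝ → B} (hg : Continuous g) {M : ℝ} (hM : ∀ s, ‖g s‖ ≤ M) (t : ℝ) :
    Integrable fun τ => greenFunction A P Q t τ (g τ) := by
  refine ((((integrable_exp_neg_mul_abs hν).comp_sub_left t).const_mul N).mul_const M).mono'
    (aestronglyMeasurable_greenFunction_apply A P Q hg t) (ae_of_all _ fun τ => ?_)
  exact ContinuousLinearMap.le_of_opNorm_le_of_le _ (hG t τ) (hM τ)

/-- The Green integral has the form given by the variation of constants. -/
theorem integral_greenFunction_apply_eq {A : C(ℝ, B →L[𝕜] B)} {P Q : B →L[𝕜] B} {g : ℝ → B}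
    (hg : Continuous g) (hint : Integrable fun τ => greenFunction A P Q 0 τ (g τ)) (t : ℝ) :
    ∫ τ, greenFunction A P Q t τ (g τ) = cauchyOperator A t
      ((∫ τ, greenFunction A P Q 0 τ (g τ)) +
        ∫ s in (0 : ℝ)..t, Ring.inverse (cauchyOperator A s) (g s)) := by
  have hc : Continuous fun s => Ring.inverse (cauchyOperator A s) (g s) :=
    (continuous_inverse_cauchyOperator A).clm_apply hg
  have hI : ∀ a b : ℝ, Integrable
      ((Set.Ico a b).indicator fun s => Ring.inverse (cauchyOperator A s) (g s)) := fun a b =>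
    ((hc.integrableOn_Icc (a := a) (b := b)).mono_set Set.Ico_subset_Icc_self).integrable_indicator
      measurableSet_Ico
  simp_rw [greenFunction_apply_eq A P Q g t]
  refine (ContinuousLinearMap.integral_comp_comm _ (hint.add ((hI 0 t).sub (hI t 0)))).trans ?_
  rw [integral_add' hint ((hI 0 t).sub (hI t 0)), integral_sub' (hI 0 t) (hI t 0),
    integral_indicator measurableSet_Ico, integral_indicator measurableSet_Ico,
    integral_Ico_sub_integral_Ico]

theorem hasDerivAt_integral_greenFunction {A : C(ℝ, B →L[𝕜] B)} {P Q : B →L[𝕜] B} {g : ℝ → B}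
    (hg : Continuous g) (hint : Integrable fun τ => greenFunction A P Q 0 τ (g τ)) (t : ℝ) :
    HasDerivAt (fun t => ∫ τ, greenFunction A P Q t τ (g τ))
      (A t (∫ τ, greenFunction A P Q t τ (g τ)) + g t) t := by
  rw [funext (integral_greenFunction_apply_eq hg hint), integral_greenFunction_apply_eq hg hint t]
  exact hasDerivAt_variation_of_constants A hg _ t

/-- If the forcing term is at most `δ` outside `[-L, L]`, the Green integral is, up to an
exponentially small error, at most the constant `N ∫ exp (-ν |s|) ds` times `δ`. -/
theorem norm_integral_greenFunction_le {A : C(ℝ, B →L[𝕜] B)} {P Q : B →L[𝕜] B} {N ν : ℝ}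
    (hN : 0 < N) (hν : 0 < ν)
    (hG : ∀ t τ, ‖greenFunction A P Q t τ‖ ≤ N * Real.exp (-ν * |t - τ|))
    {g : ℝ → B} {M δ L : ℝ} (hL : 0 ≤ L) (hδ : 0 ≤ δ) (hM0 : 0 ≤ M)
    (hM : ∀ s, ‖g s‖ ≤ M) (hgδ : ∀ s, L ≤ |s| → ‖g s‖ ≤ δ)
    (t : ℝ) :
    ‖∫ τ, greenFunction A P Q t τ (g τ)‖ ≤
      N * (∫ s, Real.exp (-ν * |s|)) * δ + 2 * L * N * M * Real.exp (-ν * (|t| - L)) := by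
  have hi1 : Integrable fun τ : ℝ => N * Real.exp (-ν * |t - τ|) * δ :=
    (((integrable_exp_neg_mul_abs hν).comp_sub_left t).const_mul N).mul_const δ
  have hi2 : Integrable ((Set.Icc (-L) L).indicator
      fun _ => N * M * Real.exp (-ν * (|t| - L))) :=
    (integrable_indicator_iff measurableSet_Icc).2 continuous_const.integrableOn_Icc
  calc ‖∫ τ, greenFunction A P Q t τ (g τ)‖
      ≤ ∫ τ, (N * Real.exp (-ν * |t - τ|) * δ + (Set.Icc (-L) L).indicator
          (fun _ => N * M * Real.exp (-ν * (|t| - L))) τ) := by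
        refine norm_integral_le_of_norm_le (hi1.add hi2) (ae_of_all _ fun τ => ?_)
        by_cases hτ : τ ∈ Set.Icc (-L) L
        · rw [Set.indicator_of_mem hτ]
          refine le_add_of_nonneg_of_le (by positivity) ?_
          refine (ContinuousLinearMap.le_of_opNorm_le_of_le _ (hG t τ) (hM τ)).trans ?_
          have h1 : |t| - L ≤ |t - τ| := by
            have := abs_sub_abs_le_abs_sub t τ
            have := abs_le.2 hτ
            linarith
          have h2 : Real.exp (-ν * |t - τ|) ≤ Real.exp (-ν * (|t| - L)) :=
            Real.exp_le_exp.2 (by nlinarith)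
          calc N * Real.exp (-ν * |t - τ|) * M = N * M * Real.exp (-ν * |t - τ|) := by ring
            _ ≤ _ := by gcongr
        · rw [Set.indicator_of_notMem hτ, add_zero]
          refine ContinuousLinearMap.le_of_opNorm_le_of_le _ (hG t τ) (hgδ τ ?_)
          exact (not_le.1 fun h => hτ (abs_le.1 h)).le
    _ = _ := by
        rw [integral_add hi1 hi2, integral_indicator measurableSet_Icc, setIntegral_const,
          integral_mul_const, integral_const_mul,
          integral_sub_left_eq_self (fun s : ℝ => Real.exp (-ν * |s|)) volume t]
        simp [Measure.real, Real.volume_Icc, ENNReal.toReal_ofReal (by linarith : 0 ≤ L + L)]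
        ring

end Equation

/-! ### Bounded solutions -/

theorem tendsto_const_mul_exp_neg {ν : ℝ} (hν : 0 < ν) (K : ℝ) :
    Tendsto (fun x => K * Real.exp (-ν * x)) atTop (𝓝 0) := by
  have h : Tendsto (fun x => -ν * x) atTop atBot :=
    tendsto_id.const_mul_atTop_of_neg (neg_neg_of_pos hν)
  simpa using (Real.tendsto_exp_atBot.comp h).const_mul K

theorem exists_norm_le_of_norm_le_outside {E : Type*} [NormedAddCommGroup E] {g : ℝ → E}
    (hg : Continuous g) {L δ : ℝ} (h : ∀ t, L ≤ |t| → ‖g t‖ ≤ δ) : ∃ M, 0 ≤ M ∧ ∀ t, ‖g t‖ ≤ M := by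
  obtain ⟨M, hM⟩ := (isCompact_Icc (a := -L) (b := L)).exists_bound_of_continuousOn hg.continuousOn
  refine ⟨max (max M δ) 0, le_max_right _ _, fun t => le_max_of_le_left ?_⟩
  rcases le_total L |t| with ht | ht
  · exact le_max_of_le_right (h t ht)
  · exact le_max_of_le_left (hM t (abs_le.1 ht))

section Equation

variable {𝕜 : Type*} [RCLike 𝕜] {B : Type*} [NormedAddCommGroup B] [NormedSpace 𝕜 B]
  [NormedSpace ℝ B] [IsScalarTower ℝ 𝕜 B] [CompleteSpace B]

/-- The initial value of a bounded solution of `x' = A(t) x` is fixed by `P` and by `Q`, because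
the complementary components grow at `+∞` and at `-∞`; such solutions vanish at infinity. -/
theorem HasExponentialTrichotomyWith.tendsto_norm_zero_of_isSolution_zero
    {A : C(ℝ, B →L[𝕜] B)} {P Q : B →L[𝕜] B} (h : HasExponentialTrichotomyWith A P Q)
    {y : C(ℝ, B)} (hy : IsSolution A 0 y) {C : ℝ} (hC : ∀ t, ‖y t‖ ≤ C) :
    Tendsto (fun t => ‖y t‖) (cocompact ℝ) (𝓝 0) := by
  obtain ⟨N, ν, hN, hν, h1, h2, h3, h4⟩ := h.bound
  have hback : ∀ τ, Ring.inverse (cauchyOperator A τ) (y τ) = y 0 := fun τ => by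
    rw [hy.eq_cauchyOperator_apply τ, ← mul_apply_eq_comp, (inverse_cauchyOperator_spec A).2.1]
    rfl
  have hcomp : ∀ S τ, evolutionThrough A S 0 τ (y τ) = S (y 0) := fun S τ => by
    rw [evolutionThrough_zero_left, mul_apply_eq_comp, hback]
  have hP : (1 - P) (y 0) = 0 := by
    rw [← norm_le_zero_iff]
    refine ge_of_tendsto (tendsto_const_mul_exp_neg hν (N * C))
      ((eventually_ge_atTop 0).mono fun τ hτ => ?_)
    rw [← hcomp (1 - P) τ]
    refine (ContinuousLinearMap.le_of_opNorm_le_of_le _ (h2 0 τ hτ hτ) (hC τ)).trans_eq ?_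
    rw [sub_zero]; ring
  have hQ : (1 - Q) (y 0) = 0 := by
    rw [← norm_le_zero_iff]
    refine ge_of_tendsto (tendsto_const_mul_exp_neg hν (N * C))
      ((eventually_ge_atTop 0).mono fun τ hτ => ?_)
    rw [← hcomp (1 - Q) (-τ)]
    refine (ContinuousLinearMap.le_of_opNorm_le_of_le _ (h4 0 (-τ) (by linarith) (by linarith))
      (hC (-τ))).trans_eq ?_
    rw [sub_neg_eq_add, zero_add]; ring
  have hP' : P (y 0) = y 0 := (sub_eq_zero.1 (by simpa using hP)).symm
  have hQ' : Q (y 0) = y 0 := (sub_eq_zero.1 (by simpa using hQ)).symm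
  have hbd : ∀ t, ‖y t‖ ≤ N * ‖y 0‖ * Real.exp (-ν * ‖t‖) := fun t => by
    rcases le_total 0 t with ht | ht
    · have hyt : y t = evolutionThrough A P t 0 (y 0) := by
        rw [evolutionThrough_zero_right, mul_apply_eq_comp, hP', ← hy.eq_cauchyOperator_apply]
      rw [hyt, Real.norm_of_nonneg ht]
      refine ((evolutionThrough A P t 0).le_of_opNorm_le (h1 t 0 le_rfl ht) _).trans_eq ?_
      rw [sub_zero]; ring
    · have hyt : y t = evolutionThrough A Q t 0 (y 0) := by
        rw [evolutionThrough_zero_right, mul_apply_eq_comp, hQ', ← hy.eq_cauchyOperator_apply]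
      rw [hyt, Real.norm_of_nonpos ht]
      refine ((evolutionThrough A Q t 0).le_of_opNorm_le (h3 t 0 ht le_rfl) _).trans_eq ?_
      rw [zero_sub]; ring
  exact squeeze_zero (fun t => norm_nonneg _) hbd
    ((tendsto_const_mul_exp_neg hν (N * ‖y 0‖)).comp (tendsto_norm_cocompact_atTop))

/-- The Green integral of a bounded continuous function is a bounded solution. -/
theorem HasExponentialTrichotomyWith.exists_bounded_solution
    {A : C(ℝ, B →L[𝕜] B)} {P Q : B →L[𝕜] B} (h : HasExponentialTrichotomyWith A P Q)
    {f : C(ℝ, B)} {M : ℝ} (hM : ∀ t, ‖f t‖ ≤ M) :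
    ∃ φ : C(ℝ, B), (∀ t, Integrable (fun τ => greenFunction A P Q t τ (f τ)) ∧
      φ t = ∫ τ, greenFunction A P Q t τ (f τ)) ∧ IsSolution A f φ ∧ ∃ C : ℝ, ∀ t, ‖φ t‖ ≤ C := by
  obtain ⟨N, ν, hN, hν, hG⟩ := h.exists_norm_greenFunction_le
  have hM0 : 0 ≤ M := (norm_nonneg _).trans (hM 0)
  have hint := fun t => integrable_greenFunction_apply hν hG f.continuous hM t
  have hder := hasDerivAt_integral_greenFunction f.continuous (hint 0)
  exact ⟨⟨_, continuous_iff_continuousAt.2 fun t => (hder t).continuousAt⟩,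
    fun t => ⟨hint t, rfl⟩, hder, N * (∫ s, Real.exp (-ν * |s|)) * M, fun t => by
      simpa using norm_integral_greenFunction_le hN hν hG le_rfl hM0 hM0 hM (fun s _ => hM s) t⟩

/-- The remote size of a bounded solution is controlled linearly by the remote size of the forcing
term. -/
theorem HasExponentialTrichotomyWith.exists_eventually_norm_solution_le
    {A : C(ℝ, B →L[𝕜] B)} {P Q : B →L[𝕜] B} (h : HasExponentialTrichotomyWith A P Q) :
    ∃ K : ℝ, 0 < K ∧ ∀ (g y : C(ℝ, B)) (C δ L ε : ℝ), IsSolution A g y → (∀ t, ‖y t‖ ≤ C) →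
      0 ≤ δ → 0 ≤ L → (∀ t, L ≤ |t| → ‖g t‖ ≤ δ) → K * δ < ε →
      ∀ᶠ t in cocompact ℝ, ‖y t‖ < ε := by
  obtain ⟨N, ν, hN, hν, hG⟩ := h.exists_norm_greenFunction_le
  have hI : 0 ≤ ∫ s : ℝ, Real.exp (-ν * |s|) := integral_nonneg fun s => (Real.exp_pos _).le
  -- The summand `1` makes the constant positive, so that it may be divided by.
  refine ⟨N * (∫ s : ℝ, Real.exp (-ν * |s|)) + 1, by positivity,
    fun g y C δ L ε hy hC hδ hL hg hε => ?_⟩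
  obtain ⟨M, hM0, hM⟩ := exists_norm_le_of_norm_le_outside g.continuous hg
  obtain ⟨z, hzG, hz, Cz, hCz⟩ := h.exists_bounded_solution hM
  have hyz : IsSolution A 0 (y - z) := fun t => by
    have h1 : HasDerivAt (y - z : C(ℝ, B)) (A t (y t) + g t - (A t (z t) + g t)) t :=
      (hy t).sub (hz t)
    convert h1 using 1
    rw [ContinuousMap.sub_apply, map_sub, ContinuousMap.zero_apply]
    abel
  have hdiff := h.tendsto_norm_zero_of_isSolution_zero hyz (C := C + Cz) fun t =>
    (norm_sub_le _ _).trans (add_le_add (hC t) (hCz t))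
  have herr : Tendsto (fun t : ℝ => 2 * L * N * M * Real.exp (-ν * (|t| - L))) (cocompact ℝ)
      (𝓝 0) :=
    (tendsto_const_mul_exp_neg hν (2 * L * N * M)).comp
      (tendsto_atTop_add_const_right _ (-L) (tendsto_norm_cocompact_atTop (E := ℝ)))
  have hlim := ((hdiff.add herr).const_add
    (N * (∫ s, Real.exp (-ν * |s|)) * δ)).eventually_lt_const (u := ε) (by linarith)
  refine hlim.mono fun t ht => lt_of_le_of_lt ?_ ht
  have h1 := norm_integral_greenFunction_le hN hν hG hL hδ hM0 hM hg t
  have h2 : ‖y t‖ ≤ ‖(y - z) t‖ + ‖z t‖ := by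
    simpa using norm_add_le ((y - z) t) (z t)
  rw [← (hzG t).2] at h1
  linarith

/-! ### Remote almost periods of bounded solutions -/

theorem eventually_cocompact_real_iff {p : ℝ → Prop} :
    (∀ᶠ t in cocompact ℝ, p t) ↔ ∃ L : ℝ, 0 < L ∧ ∀ t, L ≤ |t| → p t := by
  rw [← Metric.cobounded_eq_cocompact, ← comap_norm_atTop,
    ((atTop_basis_Ioi' (0 : ℝ)).comap _).eventually_iff]
  constructor
  · rintro ⟨L, hL, h⟩
    exact ⟨L + 1, by linarith, fun t ht => h (by simpa using by linarith)⟩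
  · rintro ⟨L, hL, h⟩
    exact ⟨L, hL, fun t ht => h t (le_of_lt (by simpa using ht))⟩

theorem twoSidedRemotelyPeriodic_iff {X : Type*} [MetricSpace X] {τ : ℝ} {φ : C(ℝ, X)} :
    TwoSidedRemotelyPeriodic τ φ ↔
      ∀ ε : ℝ, 0 < ε → ∀ᶠ t in cocompact ℝ, dist (φ (t + τ)) (φ t) < ε := by
  unfold TwoSidedRemotelyPeriodic
  rw [and_comm, ← tendsto_sup, ← cocompact_eq_atBot_atTop, Metric.tendsto_nhds]
  simp

theorem LagrangeStable.exists_dist_le {X : Type*} [MetricSpace X] {φ : C(ℝ, X)}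
    (h : LagrangeStable φ) (x : X) : ∃ M, ∀ t, dist (φ t) x ≤ M := by
  have hc := (h.image (continuous_eval_const (F := C(ℝ, X)) (0 : ℝ))).isBounded
  obtain ⟨M, hM⟩ := hc.subset_closedBall x
  refine ⟨M, fun t => hM ⟨shift t φ, subset_closure ⟨t, rfl⟩, ?_⟩⟩
  simp [shift]

/-- The difference `ψ(· + τ) - ψ` of a bounded solution solves the same linear equation with the
forcing term `(A(· + τ) - A) ψ(· + τ) + f(· + τ) - f`, which is remotely small as soon as `τ` is a
remote almost period of `(A, f)`. -/
theorem HasExponentialTrichotomyWith.exists_eventually_dist_shift_lt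
    {A : C(ℝ, B →L[𝕜] B)} {P Q : B →L[𝕜] B} (h : HasExponentialTrichotomyWith A P Q)
    {f ψ : C(ℝ, B)} (hψ : IsSolution A f ψ) (hb : ∃ C : ℝ, ∀ t, ‖ψ t‖ ≤ C) {ε : ℝ} (hε : 0 < ε) :
    ∃ δ : ℝ, 0 < δ ∧ ∀ τ : ℝ,
      (∀ᶠ t in cocompact ℝ, dist (A.prodMk f (t + τ)) (A.prodMk f t) < δ) →
      ∀ᶠ t in cocompact ℝ, dist (ψ (t + τ)) (ψ t) < ε := by
  obtain ⟨C, hC⟩ := hb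
  have hC0 : 0 ≤ C := (norm_nonneg _).trans (hC 0)
  obtain ⟨K, hK, H⟩ := h.exists_eventually_norm_solution_le
  -- The forcing term for `ψ(· + τ) - ψ` is remotely at most `δ (C + 1)`.
  refine ⟨ε / (2 * K * (C + 1)), by positivity, fun τ hτ => ?_⟩
  set δ := ε / (2 * K * (C + 1)) with hδ
  have hδ0 : 0 < δ := by positivity
  obtain ⟨L, hL, hLτ⟩ := eventually_cocompact_real_iff.1 hτ
  have key := H ⟨fun t => (A (t + τ) - A t) (ψ (t + τ)) + (f (t + τ) - f t), by fun_prop⟩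
    (shift τ ψ - ψ) (C + C) (δ * (C + 1)) L ε ?_ ?_ (by positivity) hL.le ?_ ?_
  · refine key.mono fun t ht => ?_
    rw [dist_eq_norm]
    exact ht
  · intro t
    have h1 : HasDerivAt (shift τ ψ) (A (t + τ) (ψ (t + τ)) + f (t + τ)) t :=
      (hψ (t + τ)).comp_add_const t τ
    have h2 : HasDerivAt (shift τ ψ - ψ : C(ℝ, B))
        (A (t + τ) (ψ (t + τ)) + f (t + τ) - (A t (ψ t) + f t)) t := h1.sub (hψ t)
    convert h2 using 1
    change A t (ψ (t + τ) - ψ t) + ((A (t + τ) - A t) (ψ (t + τ)) + (f (t + τ) - f t)) = _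
    rw [map_sub, sub_apply]
    abel
  · exact fun t => (norm_sub_le _ _).trans (add_le_add (hC _) (hC t))
  · intro t ht
    have h1 := hLτ t ht
    rw [Prod.dist_eq, max_lt_iff, dist_eq_norm, dist_eq_norm] at h1
    calc ‖(A (t + τ) - A t) (ψ (t + τ)) + (f (t + τ) - f t)‖ ≤ δ * C + δ :=
          (norm_add_le _ _).trans (add_le_add
            (ContinuousLinearMap.le_of_opNorm_le_of_le _ h1.1.le (hC _)) h1.2.le)
      _ = δ * (C + 1) := by ring
  · have : K * (δ * (C + 1)) = ε / 2 := by
      rw [hδ]; field_simp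
    linarith

theorem HasExponentialTrichotomyWith.twoSidedRemotelyAlmostPeriodic
    {A : C(ℝ, B →L[𝕜] B)} {P Q : B →L[𝕜] B} (h : HasExponentialTrichotomyWith A P Q)
    {f ψ : C(ℝ, B)} (hψ : IsSolution A f ψ) (hb : ∃ C : ℝ, ∀ t, ‖ψ t‖ ≤ C)
    (hAf : TwoSidedRemotelyAlmostPeriodic (A.prodMk f)) : TwoSidedRemotelyAlmostPeriodic ψ := by
  intro ε hε
  obtain ⟨δ, hδ, H⟩ := h.exists_eventually_dist_shift_lt hψ hb hε
  obtain ⟨S, hS, hSδ⟩ := hAf δ hδ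
  exact ⟨S, hS, fun τ hτ => eventually_cocompact_real_iff.1
    (H τ (eventually_cocompact_real_iff.2 (hSδ τ hτ)))⟩

theorem HasExponentialTrichotomyWith.twoSidedRemotelyPeriodic
    {A : C(ℝ, B →L[𝕜] B)} {P Q : B →L[𝕜] B} (h : HasExponentialTrichotomyWith A P Q)
    {f ψ : C(ℝ, B)} (hψ : IsSolution A f ψ) (hb : ∃ C : ℝ, ∀ t, ‖ψ t‖ ≤ C) {τ : ℝ}
    (hAf : TwoSidedRemotelyPeriodic τ (A.prodMk f)) : TwoSidedRemotelyPeriodic τ ψ := by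
  rw [twoSidedRemotelyPeriodic_iff] at hAf ⊢
  intro ε hε
  obtain ⟨δ, hδ, H⟩ := h.exists_eventually_dist_shift_lt hψ hb hε
  exact H τ (hAf δ hδ)

end Equation
theorem theorem5p3 {𝕜 : Type*} [RCLike 𝕜] {B : Type*} [NormedAddCommGroup B] [NormedSpace 𝕜 B]
    [NormedSpace ℝ B] [IsScalarTower ℝ 𝕜 B] [CompleteSpace B]
    (A : C(ℝ, B →L[𝕜] B)) (f : C(ℝ, B))
    (hLagrange : LagrangeStable (A.prodMk f))
    (P Q : B →L[𝕜] B) (hTrichotomy : HasExponentialTrichotomyWith A P Q) :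
    ∃ φ : C(ℝ, B),
      (∀ t : ℝ, MeasureTheory.Integrable (fun τ : ℝ => greenFunction A P Q t τ (f τ)) ∧
        φ t = ∫ τ : ℝ, greenFunction A P Q t τ (f τ)) ∧
      IsSolution A f φ ∧
      (TwoSidedRemotelyAlmostPeriodic (A.prodMk f) →
        TwoSidedRemotelyAlmostPeriodic φ ∧
        ∀ ψ : C(ℝ, B), IsSolution A f ψ → (∃ C : ℝ, ∀ t : ℝ, ‖ψ t‖ ≤ C) →
          TwoSidedRemotelyAlmostPeriodic ψ) ∧
      (∀ τ : ℝ, 0 < τ → TwoSidedRemotelyPeriodic τ (A.prodMk f) →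
        TwoSidedRemotelyPeriodic τ φ ∧
        ∀ ψ : C(ℝ, B), IsSolution A f ψ → (∃ C : ℝ, ∀ t : ℝ, ‖ψ t‖ ≤ C) →
          TwoSidedRemotelyPeriodic τ ψ) ∧
      (TwoSidedRemotelyStationary (A.prodMk f) →
        TwoSidedRemotelyStationary φ ∧
        ∀ ψ : C(ℝ, B), IsSolution A f ψ → (∃ C : ℝ, ∀ t : ℝ, ‖ψ t‖ ≤ C) →
          TwoSidedRemotelyStationary ψ) := by
  obtain ⟨M, hM⟩ := hLagrange.exists_dist_le 0
  have hf : ∀ t, ‖f t‖ ≤ M := fun t => by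
    have := (norm_snd_le (A.prodMk f t)).trans (dist_zero_right (A.prodMk f t) ▸ hM t)
    exact this
  obtain ⟨φ, hφ, hsol, hb⟩ := hTrichotomy.exists_bounded_solution hf
  exact ⟨φ, hφ, hsol,
    fun hAf => ⟨hTrichotomy.twoSidedRemotelyAlmostPeriodic hsol hb hAf,
      fun ψ hψ hψb => hTrichotomy.twoSidedRemotelyAlmostPeriodic hψ hψb hAf⟩,
    fun τ _ hAf => ⟨hTrichotomy.twoSidedRemotelyPeriodic hsol hb hAf,
      fun ψ hψ hψb => hTrichotomy.twoSidedRemotelyPeriodic hψ hψb hAf⟩,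
    fun hAf => ⟨fun τ hτ => hTrichotomy.twoSidedRemotelyPeriodic hsol hb (hAf τ hτ),
      fun ψ hψ hψb τ hτ => hTrichotomy.twoSidedRemotelyPeriodic hψ hψb (hAf τ hτ)⟩⟩
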